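/- For every infinite cardinal number $\kappa$ there is a $\sigma$-compact $\mathsf{T}_0$ topological group $G$ of cardinality $\kappa$ such that player TWO has a winning strategy in the game $\mathsf{G}_1(\Omega,\Gamma)$ on $G$. Here $\Omega$ is the family of all open covers $\mathcal{U}$ of $G$ such that $G\notin\mathcal{U}$ and every finite subset of $G$ is contained in some member of $\mathcal{U}$, and $\Gamma$ is the family of all infinite open covers $\mathcal{U}$ of $G$ such that every infinite subset of $\mathcal{U}$ covers $G$. In $\mathsf{G}_1(\Omega,\Gamma)$ the players play one inning for each $n<\omega$: in inning $n$ ONE selects $O_n\in\Omega$, and TWO then responds with some $T_n\in O_n$. TWO wins the play if $\{T_n : n<\omega\}\in\Gamma$; otherwise ONE wins. A strategy for TWO is a perfect-information strategy: $T_n$ is determined by $(O_0,\dots,O_n)$. -/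

import Mathlib

universe u

/-- Open `ω`-covers of a space `X`: open covers that do not contain `X` itself and such that every
finite subset of `X` is contained in some member. -/
def openOmegaCovers (X : Type*) [TopologicalSpace X] : Set (Set (Set X)) :=
  {U | (∀ V ∈ U, IsOpen V) ∧ ⋃₀ U = Set.univ ∧ Set.univ ∉ U ∧
    ∀ F : Set X, F.Finite → ∃ V ∈ U, F ⊆ V}

/-- Open `γ`-covers of a space `X`: infinite open covers each of whose infinite subsets
still covers `X`. -/
def openGammaCovers (X : Type*) [TopologicalSpace X] : Set (Set (Set X)) :=
  {U | (∀ V ∈ U, IsOpen V) ∧ ⋃₀ U = Set.univ ∧ U.Infinite ∧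
    ∀ W ⊆ U, W.Infinite → ⋃₀ W = Set.univ}

/-- A strategy for TWO in a game of length `ω` in which ONE plays sets of elements of `α` and TWO
plays elements of `α`: in inning `n` it assigns a response to the moves `O 0, …, O n` that ONE has
made so far (perfect information). -/
abbrev TwoStrategy (α : Type*) : Type _ :=
  (n : ℕ) → (Fin (n + 1) → Set α) → α

/-- TWO's move in inning `n` when ONE plays the sequence `O` and TWO follows `σ`. -/
def TwoStrategy.response {α : Type*} (σ : TwoStrategy α) (O : ℕ → Set α) (n : ℕ) : α :=
  σ n fun i => O i

/-- `σ` is a winning strategy for TWO in the game `G₁(A, B)`: ONE plays `O n ∈ A`, TWO answers with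
an element `T n ∈ O n`, and TWO wins if `{T n : n < ω} ∈ B`. -/
def TwoStrategy.IsWinning {α : Type*} (σ : TwoStrategy α) (A B : Set (Set α)) : Prop :=
  ∀ O : ℕ → Set α, (∀ n, O n ∈ A) →
    (∀ n, σ.response O n ∈ O n) ∧ Set.range (σ.response O) ∈ B

/-- TWO has a winning strategy in the game `G₁(A, B)`. -/
def TwoHasWinningStrategyG1 {α : Type*} (A B : Set (Set α)) : Prop :=
  ∃ σ : TwoStrategy α, σ.IsWinning A B

/-! Take the finitely supported functions in a power of a finite discrete group. TWO keeps a finite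
set `A n` of coordinates. The functions supported in `A n` are finitely many, so some member `T n`
of ONE's cover contains them all; openness gives a finite `A (n + 1) ⊇ A n` such that `T n` contains
the cylinders over `A (n + 1)` around them. Since `x` has finite support, eventually no new
coordinate lies in that support; then `x` agrees on `A (n + 1)` with its restriction to `A n`, so `x
∈ T n`. -/

/-- The subgroup of a power of `H` that consists of the functions of finite support. -/
def finiteSupportSubgroup (ι : Type*) (H : Type*) [Group H] : Subgroup (ι → H) where
  carrier := {x | (Function.mulSupport x).Finite}
  one_mem' := by simp [Function.mulSupport_one]
  mul_mem' {x y} hx hy := (hx.union hy).subset (Function.mulSupport_mul x y)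
  inv_mem' {x} hx := by simpa [Function.mulSupport_inv] using hx

theorem sigmaCompactSpace_finiteSupportSubgroup (ι H : Type*) [Group H] [Finite H]
    [TopologicalSpace H] [DiscreteTopology H] :
    SigmaCompactSpace (finiteSupportSubgroup ι H) := by
  -- `K n` consists of the functions with support of size at most `n`: closed in the compact full
  -- power.
  let K : ℕ → Set (ι → H) := fun n =>
    ⋂ S : {S : Finset ι // S.card = n + 1}, ⋃ i ∈ S.1, {x | x i = 1}
  have hKclosed : ∀ n, IsClosed (K n) := fun n => isClosed_iInter fun S =>
    S.1.finite_toSet.isClosed_biUnion fun i _ => isClosed_eq (continuous_apply i) continuous_const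
  have hKsub : ∀ n, K n ⊆ Set.range ((↑) : finiteSupportSubgroup ι H → ι → H) := by
    intro n x hx
    rw [Subtype.range_coe]
    by_contra hinf
    obtain ⟨S, hS, hcard⟩ := Set.Infinite.exists_subset_card_eq (s := Function.mulSupport x)
      hinf (n + 1)
    have := Set.mem_iInter.1 hx ⟨S, hcard⟩
    simp only [Set.mem_iUnion, Set.mem_ofPred_eq] at this
    obtain ⟨i, hi, h1⟩ := this
    exact hS hi h1
  refine ⟨⟨fun n => (↑) ⁻¹' K n, fun n => ?_, ?_⟩⟩
  · exact Topology.IsInducing.subtypeVal.isCompact_preimage' (hKclosed n).isCompact (hKsub n)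
  · refine Set.eq_univ_of_forall fun x => Set.mem_iUnion.2 ?_
    have hx : (Function.mulSupport x.1).Finite := x.2
    refine ⟨hx.toFinset.card, Set.mem_iInter.2 fun S => ?_⟩
    by_contra hne
    simp only [Set.mem_iUnion, Set.mem_ofPred_eq, not_exists] at hne
    have : S.1 ⊆ hx.toFinset := fun i hi => hx.mem_toFinset.2 (hne i hi)
    have := Finset.card_le_card this
    have := S.2
    omega

theorem mk_finiteSupportSubgroup (ι : Type u) (H : Type) [Group H] [Finite H] [Nontrivial H]
    [Infinite ι] : Cardinal.mk (finiteSupportSubgroup ι H) = Cardinal.mk ι := by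
  classical
  apply le_antisymm
  · have hinj : Function.Injective fun x : finiteSupportSubgroup ι H =>
        Finsupp.ofSupportFinite (fun i => Additive.ofMul (x.1 i)) x.2 := by
      intro x y hxy
      ext i
      exact DFunLike.congr_fun hxy i
    refine (Cardinal.mk_le_of_injective hinj).trans ?_
    rw [Cardinal.mk_finsupp_lift_of_infinite]
    have hH : Cardinal.mk (Additive H) ≤ Cardinal.aleph0 := (Cardinal.lt_aleph0_of_finite _).le
    simpa using (Cardinal.lift_le.{u}.2 hH).trans
      (by simp : Cardinal.lift.{u} Cardinal.aleph0.{0} ≤ Cardinal.mk ι)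
  · obtain ⟨h, hh⟩ := exists_ne (1 : H)
    refine Cardinal.mk_le_of_injective (f := fun i =>
      (⟨Pi.mulSingle i h, (Set.finite_singleton i).subset Pi.mulSupport_mulSingle_subset⟩ :
        finiteSupportSubgroup ι H)) fun i j hij => ?_
    by_contra hne
    have := congrFun (Subtype.ext_iff.1 hij) i
    simp [Pi.mulSingle_eq_of_ne hne, hh] at this

/-- If TWO wins by keeping a state that is updated by each move of ONE, then TWO has a winning
strategy. -/
theorem twoHasWinningStrategyG1_of_state {α β : Type*} {A B : Set (Set α)} (s₀ : β)
    (next : β → Set α → β) (pick : β → Set α → α)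
    (h : ∀ (O : ℕ → Set α) (s : ℕ → β), (∀ n, O n ∈ A) → s 0 = s₀ →
      (∀ n, s (n + 1) = next (s n) (O n)) →
      (∀ n, pick (s n) (O n) ∈ O n) ∧ (Set.range fun n => pick (s n) (O n)) ∈ B) :
    TwoHasWinningStrategyG1 A B := by
  let state : (ℕ → Set α) → ℕ → β := fun O n => Nat.rec s₀ (fun k s => next s (O k)) n
  have hstate : ∀ (O O' : ℕ → Set α) (n : ℕ), (∀ k < n, O k = O' k) → state O n = state O' n := by
    intro O O' n
    induction n with
    | zero => intro _; rfl
    | succ n ih =>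
      intro hO
      change next (state O n) (O n) = next (state O' n) (O' n)
      rw [ih fun k hk => hO k (by omega), hO n (by omega)]
  -- `Fin.ofNat` extends the finite history periodically; the state at `n` only reads moves before
  -- `n`.
  refine ⟨fun n O => pick (state (fun k => O (Fin.ofNat (n + 1) k)) n) (O (Fin.last n)),
    fun O hO => ?_⟩
  have hresp : TwoStrategy.response (fun n O =>
      pick (state (fun k => O (Fin.ofNat (n + 1) k)) n) (O (Fin.last n))) O =
      fun n => pick (state O n) (O n) := by
    funext n
    simp only [TwoStrategy.response, Fin.val_last]
    rw [hstate _ O n fun k hk => by simp [Nat.mod_eq_of_lt (Nat.lt_succ_of_lt hk)]]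
  rw [hresp]
  exact h O (state O) hO rfl fun _ => rfl

/-- Responses to `ω`-covers that eventually contain each point form a `γ`-cover. -/
theorem range_mem_openGammaCovers {X : Type*} [TopologicalSpace X] {O : ℕ → Set (Set X)}
    (hO : ∀ n, O n ∈ openOmegaCovers X) {T : ℕ → Set X} (hT : ∀ n, T n ∈ O n)
    (h : ∀ x, ∀ᶠ n in Filter.atTop, x ∈ T n) : Set.range T ∈ openGammaCovers X := by
  have hcover : ∀ W ⊆ Set.range T, W.Infinite → ⋃₀ W = Set.univ := by
    intro W hW hinf
    refine Set.eq_univ_of_forall fun x => ?_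
    obtain ⟨N, hN⟩ := Filter.eventually_atTop.1 (h x)
    obtain ⟨V, hVW, hV⟩ := (hinf.sdiff ((Set.finite_Iio N).image T)).nonempty
    obtain ⟨n, rfl⟩ := hW hVW
    refine ⟨T n, hVW, hN n ?_⟩
    by_contra hn
    exact hV ⟨n, not_le.1 hn, rfl⟩
  have hinf : (Set.range T).Infinite := by
    intro hfin
    have : Finite (Set.range T) := hfin
    -- A value taken infinitely often contains every point, but `ω`-covers exclude the whole space.
    obtain ⟨V, hV⟩ := Finite.exists_infinite_fiber (Set.rangeFactorization T)
    have hfreq : ∃ᶠ n in Filter.atTop, T n = V.1 := by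
      rw [Nat.frequently_atTop_iff_infinite]
      convert Set.infinite_coe_iff.1 hV using 1
      ext n
      simp [Set.rangeFactorization, Subtype.ext_iff]
    obtain ⟨n, hn⟩ := V.2
    refine (hO n).2.2.1 ?_
    convert hT n
    refine (Set.eq_univ_of_forall fun x => ?_).symm
    obtain ⟨m, hm, hx⟩ := (hfreq.and_eventually (h x)).exists
    rw [hn, ← hm]
    exact hx
  refine ⟨?_, hcover _ subset_rfl hinf, hinf, hcover⟩
  rintro _ ⟨n, rfl⟩
  exact (hO n).1 _ (hT n)

/-- An open set contains with each point of a finite set a cylinder around it, over a common finite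
set of coordinates. -/
theorem exists_finset_cylinder_subset {ι H : Type*} [TopologicalSpace H] [DiscreteTopology H]
    {Y : Set (ι → H)} {V F : Set Y} (hV : IsOpen V) (hF : F.Finite) (hFV : F ⊆ V) (A : Finset ι) :
    ∃ A' : Finset ι, A ⊆ A' ∧ ∀ f ∈ F, ∀ x : Y, (∀ i ∈ A', x.1 i = f.1 i) → x ∈ V := by
  classical
  have hpoint : ∀ f ∈ V, ∃ B : Finset ι, ∀ x : Y, (∀ i ∈ B, x.1 i = f.1 i) → x ∈ V := by
    intro f hf
    obtain ⟨W, hW, rfl⟩ := isOpen_induced_iff.1 hV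
    obtain ⟨B, u, hu, hsub⟩ := isOpen_pi_iff.1 hW f.1 hf
    refine ⟨B, fun x hx => hsub fun i hi => ?_⟩
    rw [hx i hi]
    exact (hu i hi).2
  choose! B hB using hpoint
  refine ⟨A ∪ hF.toFinset.biUnion B, Finset.subset_union_left, fun f hf x hx =>
    hB f (hFV hf) x fun i hi => hx i ?_⟩
  exact Finset.mem_union_right _ (Finset.mem_biUnion.2 ⟨f, hF.mem_toFinset.2 hf, hi⟩)

theorem finite_setOf_mulSupport_subset {ι H : Type*} [Group H] [Finite H] (A : Finset ι) :
    {x : finiteSupportSubgroup ι H | Function.mulSupport x.1 ⊆ A}.Finite := by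
  refine Set.Finite.of_finite_image (f := fun x (i : A) => x.1 i) (Set.toFinite _) ?_
  intro x hx y hy hxy
  ext i
  by_cases hi : i ∈ A
  · exact congrFun hxy ⟨i, hi⟩
  · rw [Function.notMem_mulSupport.1 fun h => hi (hx h),
      Function.notMem_mulSupport.1 fun h => hi (hy h)]

theorem twoHasWinningStrategyG1_finiteSupportSubgroup (ι H : Type*) [Group H] [Finite H]
    [TopologicalSpace H] [DiscreteTopology H] :
    TwoHasWinningStrategyG1 (openOmegaCovers (finiteSupportSubgroup ι H))
      (openGammaCovers (finiteSupportSubgroup ι H)) := by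
  classical
  have hmove : ∀ (A : Finset ι) (U : Set (Set (finiteSupportSubgroup ι H))),
      ∃ p : Set (finiteSupportSubgroup ι H) × Finset ι, U ∈ openOmegaCovers _ →
        p.1 ∈ U ∧ A ⊆ p.2 ∧ ∀ f : finiteSupportSubgroup ι H, Function.mulSupport f.1 ⊆ A →
          ∀ x : finiteSupportSubgroup ι H, (∀ i ∈ p.2, x.1 i = f.1 i) → x ∈ p.1 := by
    intro A U
    by_cases hU : U ∈ openOmegaCovers (finiteSupportSubgroup ι H)
    · obtain ⟨V, hVU, hV⟩ := hU.2.2.2 _ (finite_setOf_mulSupport_subset A)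
      obtain ⟨A', hA, hA'⟩ := exists_finset_cylinder_subset
        (Y := (finiteSupportSubgroup ι H : Set (ι → H))) (hU.1 V hVU)
        (finite_setOf_mulSupport_subset A) hV A
      exact ⟨(V, A'), fun _ => ⟨hVU, hA, hA'⟩⟩
    · exact ⟨(∅, A), fun h => absurd h hU⟩
  choose move hmove using hmove
  refine twoHasWinningStrategyG1_of_state ∅ (fun A U => (move A U).2) (fun A U => (move A U).1)
    fun O A hO _ hA => ?_
  have hT := fun n => (hmove (A n) (O n) (hO n)).1
  refine ⟨hT, range_mem_openGammaCovers hO hT fun x => ?_⟩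
  have hmono : Monotone A := monotone_nat_of_le_succ fun n => by
    rw [hA n]
    exact (hmove (A n) (O n) (hO n)).2.1
  have hx : (Function.mulSupport x.1).Finite := x.2
  -- The sets `A n` need not exhaust `ι`; it is enough that each coordinate enters at most once.
  have hstable : ∀ i, ∀ᶠ n in Filter.atTop, i ∈ A (n + 1) → i ∈ A n := by
    intro i
    by_cases hi : ∃ N, i ∈ A N
    · obtain ⟨N, hN⟩ := hi
      filter_upwards [Filter.eventually_ge_atTop N] with n hn _ using hmono hn hN
    · exact Filter.Eventually.of_forall fun n hn => absurd ⟨_, hn⟩ hi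
  filter_upwards [(Filter.eventually_all_finite hx).2 fun i _ => hstable i] with n hn
  let f : ι → H := fun i => if i ∈ A n then x.1 i else 1
  have hfA : Function.mulSupport f ⊆ A n := by
    intro i hi
    by_contra h
    exact hi (if_neg h)
  refine (hmove (A n) (O n) (hO n)).2.2 ⟨f, (A n).finite_toSet.subset hfA⟩ hfA x fun i hi => ?_
  rw [← hA n] at hi
  by_cases h1 : x.1 i = 1
  · simp [f, h1]
  · exact (if_pos (hn i h1 hi)).symm

theorem corollary15 (κ : Cardinal.{u}) (hκ : Cardinal.aleph0 ≤ κ) :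
    ∃ (G : Type u) (_ : Group G) (_ : TopologicalSpace G),
      IsTopologicalGroup G ∧ T0Space G ∧ SigmaCompactSpace G ∧ Cardinal.mk G = κ ∧
        TwoHasWinningStrategyG1 (openOmegaCovers G) (openGammaCovers G) := by
  have : Nontrivial ℤˣ := ⟨1, -1, by decide⟩
  have : Infinite κ.out := Cardinal.infinite_iff.2 (by rwa [Cardinal.mk_out])
  exact ⟨finiteSupportSubgroup κ.out ℤˣ, inferInstance, inferInstance, inferInstance,
    inferInstance, sigmaCompactSpace_finiteSupportSubgroup _ _,
    (mk_finiteSupportSubgroup _ _).trans (Cardinal.mk_out κ),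
    twoHasWinningStrategyG1_finiteSupportSubgroup _ _⟩
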